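/- For $\alpha\in\mathbb R$ let $\mathbb E_\alpha$ be the Banach space of complex sequences $u=(u_n)_{n\ge 0}$ with $\|u\|_\alpha:=\sum_{n\ge0}|u_n|e^{\alpha n}<\infty$, so that $\mathbb E_\alpha\subset\mathbb E_{\alpha'}$ for $\alpha'<\alpha$. Let $(a_{nk})_{n,k\ge0}$ be an infinite complex matrix. Assume: (E1) $a_{nk}=-\delta_{nk}d_n+b_{nk}+c_{nk}$ for all $n,k\ge 0$, with $d_n\in(0,\infty)$ and $b_{nk},c_{nk}\in\mathbb C$. (E2) There are $\alpha_*\in\mathbb R$ and, for every $\alpha>\alpha_*$, a constant $q(\alpha)\in(0,1)$ such that $e^{-\alpha k}\sum_{n\ge0}|b_{nk}|e^{\alpha n}\le q(\alpha)d_k$ for all $k\ge0$ and $\alpha>\alpha_*$. (E3) $\sup_{n} d_ne^{-\nu n}<\infty$ for every $\nu>0$. (E4) There is a continuous increasing function $M:(\alpha_*,\infty)\to(0,\infty)$ such that $e^{-\alpha k}\sum_{n\ge0}|c_{nk}|e^{\alpha' n}\le \dfrac{M(\alpha)}{\alpha-\alpha'}$ for all $k\ge0$ and $\alpha_*<\alpha'<\alpha$.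 Consider the infinite linear system $$\frac{du_n(t)}{dt}=\sum_{k=0}^\infty a_{nk}u_k(t),\qquad u_n(0)=x_n,\qquad n\ge0.\tag{1}$$ A classical solution of (1) in $\mathbb E_\beta$ on $[0,T)$ is a function $u:[0,T)\to\mathbb E_\beta$ that is continuously differentiable with respect to $\|\cdot\|_\beta$ (one-sidedly at $0$), with $u(0)=x$, such that for every $t\in[0,T)$ and every $n\ge0$ the series in (1) converges absolutely and equals the $n$-th coordinate of $u'(t)$. Theorem. Let $\alpha_*<\alpha'<\alpha$, $x\in\mathbb E_\alpha$ and $T(\alpha',\alpha):=\dfrac{\alpha-\alpha'}{2eM(\alpha)}$. Then (1) has exactly one classical solution $u$ in $\mathbb E_{\alpha'}$ on $[0,T(\alpha',\alpha))$. Moreover, uniqueness holds in the following larger class: every continuous function $v:[0,T(\alpha',\alpha))\to\mathbb E_{\alpha'}$ that is, for every $\beta\in(\alpha_*,\alpha')$, a classical solution of (1) in $\mathbb E_\beta$ on $[0,T(\alpha',\alpha))$ equals $u$. -/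

import Mathlib

/-- The complex sequences `u` with `∑ n, |u n| * exp (α * n) < ∞`, as a linear subspace. -/
def weightedSubmodule (α : ℝ) : Submodule ℂ (ℕ → ℂ) where
  carrier := {u | Summable fun n : ℕ => ‖u n‖ * Real.exp (α * n)}
  add_mem' := by
    intro u v hu hv
    refine Summable.of_nonneg_of_le (fun n => by positivity) (fun n => ?_) (Summable.add hu hv)
    rw [← add_mul]
    exact mul_le_mul_of_nonneg_right (norm_add_le _ _) (Real.exp_pos _).le
  zero_mem' := by simp
  smul_mem' := by
    intro c u hu
    have h := Summable.mul_left ‖c‖ hu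
    simpa [mul_assoc] using h

/-- The weighted sequence space `E_α`. -/
def WeightedL1 (α : ℝ) : Type := weightedSubmodule α

namespace WeightedL1

instance instAddCommGroup (α : ℝ) : AddCommGroup (WeightedL1 α) :=
  inferInstanceAs (AddCommGroup (weightedSubmodule α))

instance instModule (α : ℝ) : Module ℂ (WeightedL1 α) :=
  inferInstanceAs (Module ℂ (weightedSubmodule α))

instance instCoeFun (α : ℝ) : CoeFun (WeightedL1 α) (fun _ => ℕ → ℂ) := ⟨fun u => u.1⟩

noncomputable instance instNorm (α : ℝ) : Norm (WeightedL1 α) :=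
  ⟨fun u => ∑' n : ℕ, ‖u n‖ * Real.exp (α * n)⟩

theorem summable {α : ℝ} (u : WeightedL1 α) :
    Summable fun n : ℕ => ‖u n‖ * Real.exp (α * n) := u.2

theorem norm_def {α : ℝ} (u : WeightedL1 α) :
    ‖u‖ = ∑' n : ℕ, ‖u n‖ * Real.exp (α * n) := rfl

theorem add_apply {α : ℝ} (u v : WeightedL1 α) (n : ℕ) : (u + v) n = u n + v n := rfl

theorem smul_apply {α : ℝ} (c : ℂ) (u : WeightedL1 α) (n : ℕ) : (c • u) n = c * u n := rfl

theorem zero_apply {α : ℝ} (n : ℕ) : (0 : WeightedL1 α) n = 0 := rfl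

theorem normCore (α : ℝ) : NormedSpace.Core ℂ (WeightedL1 α) where
  norm_nonneg u := tsum_nonneg fun n => by positivity
  norm_smul c u := by
    rw [norm_def, norm_def, ← tsum_mul_left]
    exact tsum_congr fun n => by rw [smul_apply, norm_mul, mul_assoc]
  norm_triangle u v := by
    rw [norm_def, norm_def, norm_def, ← Summable.tsum_add u.summable v.summable]
    refine Summable.tsum_le_tsum (fun n => ?_) (u + v).summable (u.summable.add v.summable)
    rw [← add_mul, add_apply]
    exact mul_le_mul_of_nonneg_right (norm_add_le _ _) (Real.exp_pos _).le
  norm_eq_zero_iff u := by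
    constructor
    · intro h
      have h1 : HasSum (fun n : ℕ => ‖u n‖ * Real.exp (α * n)) 0 := by
        have h2 := u.summable.hasSum
        rwa [← norm_def, h] at h2
      rw [hasSum_zero_iff_of_nonneg fun n => by positivity] at h1
      refine Subtype.ext (funext fun n => ?_)
      have h3 := congrFun h1 n
      rw [zero_apply]
      simpa [(Real.exp_pos _).ne'] using h3
    · rintro rfl
      simp [norm_def, zero_apply]

noncomputable instance instNormedAddCommGroup (α : ℝ) : NormedAddCommGroup (WeightedL1 α) :=
  NormedAddCommGroup.ofCore (normCore α)

noncomputable instance instNormedSpace (α : ℝ) : NormedSpace ℂ (WeightedL1 α) :=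
  NormedSpace.ofCore (normCore α)

/-- The embedding `E_α ⊆ E_β` for `β ≤ α`. -/
def embed {α β : ℝ} (h : β ≤ α) (u : WeightedL1 α) : WeightedL1 β :=
  ⟨u.1, by
    refine Summable.of_nonneg_of_le (fun n => by positivity) (fun n => ?_) u.summable
    exact mul_le_mul_of_nonneg_left (Real.exp_le_exp.2 (by gcongr)) (norm_nonneg _)⟩

end WeightedL1

/-- `u` is a classical solution in `E_α` on `[0, T)` of the infinite linear system
`u_n' = ∑ k, a n k * u_k`, `u_n(0) = x_n`: it is continuously differentiable for the norm
of `E_α` (one-sidedly at `0`), and for every `n` the series on the right-hand side converges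
absolutely and equals the `n`-th coordinate of the derivative. -/
structure IsClassicalSolution (a : ℕ → ℕ → ℂ) (x : ℕ → ℂ) (T : ℝ) {α : ℝ}
    (u : ℝ → WeightedL1 α) : Prop where
  initial : ∀ n, u 0 n = x n
  ode : ∃ u' : ℝ → WeightedL1 α,
    ContinuousOn u' (Set.Ico 0 T) ∧
    ∀ t ∈ Set.Ico 0 T,
      HasDerivWithinAt u (u' t) (Set.Ico 0 T) t ∧
      ∀ n, HasSum (fun k => a n k * u t k) (u' t n)

/-- `u` is a solution in the scale `(E_β)_{β > αs}` with values in `E_α` on `[0, T)`: it is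
continuous in `E_α`, and for every `β ∈ (αs, α)` it is continuously differentiable in the
larger space `E_β` and solves the system there. -/
structure IsScaleSolution (a : ℕ → ℕ → ℂ) (x : ℕ → ℂ) (T αs : ℝ) {α : ℝ}
    (u : ℝ → WeightedL1 α) : Prop where
  continuousOn : ContinuousOn u (Set.Ico 0 T)
  ode : ∀ (β : ℝ) (hβ : β < α), αs < β →
    IsClassicalSolution a x T (fun t => WeightedL1.embed hβ.le (u t))

section

open WeightedL1 Filter Topology

/-! ### Weighted `ℓ¹` spaces: coordinates, embeddings, completeness. -/

namespace WeightedL1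

/-! The part `-d + b` is dissipative on every weighted space: the `ℓ¹` norm is additive along a
nonnegative diagonal, and `b` is dominated by `d` (`le_norm_sub_smul`). So only `c` and external
forcing can make norms grow (`norm_le_of_dissipative`). Passing from weight `γ` to `β`, `c` costs `M
/ (γ - β)`; growth is therefore measured against `D / (D - s)` with `D = a * (top - β)`, in the
manner of Ovsyannikov and Nishida. A well-chosen intermediate `γ` turns a bound with constant `Φ`
into one with `X + 4 * a * M * Φ` (`apriori_step`), and for `4 * a * M < 1` iteration leaves a
constant depending only on the data (`apriori`). The lifespan in the theorem is `a = 1 / (2 * e *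
M)`, where `4 * a * M = 2 / e < 1`.

Uniqueness: zero data force zero on a time window whose length does not depend on the starting time
(`eq_zero_of_deriv`). Existence: keeping the first `N` columns gives a bounded operator, solved by
its exponential. Truncation preserves the structure and `M`, so the bounds are uniform in `N`. A
difference of two truncated solutions obeys a truncated equation with forcing exponentially small in
`N`, after a small loss of weight (`evolves_sub`). Hence the solutions converge uniformly on compact
time intervals, and a further loss of weight gives the same for their derivatives
(`exists_uniform_limit`). -/

theorem sub_apply {α : ℝ} (u v : WeightedL1 α) (n : ℕ) : (u - v) n = u n - v n := rfl

theorem real_smul_apply {α : ℝ} (c : ℝ) (u : WeightedL1 α) (n : ℕ) : (c • u) n = (c : ℂ) * u n :=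
  rfl

theorem embed_apply {α β : ℝ} (h : β ≤ α) (u : WeightedL1 α) (n : ℕ) : embed h u n = u n := rfl

@[ext]
theorem ext {α : ℝ} {u v : WeightedL1 α} (h : ∀ n, u n = v n) : u = v :=
  Subtype.ext (funext h)

theorem norm_apply_le {α : ℝ} (u : WeightedL1 α) (n : ℕ) :
    ‖u n‖ ≤ Real.exp (-(α * n)) * ‖u‖ := by
  have h : ‖u n‖ * Real.exp (α * n) ≤ ‖u‖ :=
    u.summable.le_tsum n fun _ _ => by positivity
  calc ‖u n‖ = Real.exp (-(α * n)) * (‖u n‖ * Real.exp (α * n)) := by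
        rw [mul_left_comm, ← Real.exp_add]; simp
    _ ≤ _ := by gcongr

/-- Evaluation of the `n`-th coordinate. -/
noncomputable def coordCLM (α : ℝ) (n : ℕ) : WeightedL1 α →L[ℂ] ℂ :=
  LinearMap.mkContinuous
    { toFun := fun u => u n
      map_add' := fun _ _ => rfl
      map_smul' := fun _ _ => rfl } (Real.exp (-(α * n))) fun u => norm_apply_le u n

theorem coordCLM_apply {α : ℝ} (n : ℕ) (u : WeightedL1 α) : coordCLM α n u = u n := rfl

theorem norm_embed_le {α β : ℝ} (h : β ≤ α) (u : WeightedL1 α) : ‖embed h u‖ ≤ ‖u‖ := by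
  rw [norm_def, norm_def]
  refine Summable.tsum_le_tsum (fun n => ?_) (embed h u).summable u.summable
  rw [embed_apply]
  gcongr

/-- The embedding `E_α ⊆ E_β` as a continuous linear map. -/
noncomputable def embedCLM {α β : ℝ} (h : β ≤ α) : WeightedL1 α →L[ℂ] WeightedL1 β :=
  LinearMap.mkContinuous
    { toFun := embed h
      map_add' := fun _ _ => rfl
      map_smul' := fun _ _ => rfl } 1 fun u =>
    (norm_embed_le h u).trans_eq (one_mul _).symm

/-- The isometric linear map from `E_α` to `ℓ¹`. -/
noncomputable def toLp (α : ℝ) (u : WeightedL1 α) : lp (fun _ : ℕ => ℂ) 1 :=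
  ⟨fun n => u n * (Real.exp (α * n) : ℂ), by
    refine memℓp_gen ?_
    simpa [Complex.norm_exp] using u.summable⟩

theorem toLp_isometry (α : ℝ) : Isometry (toLp α) := by
  refine Isometry.of_dist_eq fun u v => ?_
  rw [dist_eq_norm, dist_eq_norm, norm_def, lp.norm_eq_tsum_rpow (by simp)]
  simp only [ENNReal.toReal_one, Real.rpow_one, div_one]
  refine tsum_congr fun n => ?_
  have : (toLp α u - toLp α v : lp (fun _ : ℕ => ℂ) 1) n = (u - v) n * (Real.exp (α * n) : ℂ) := by
    rw [sub_apply, sub_mul]; rfl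
  rw [this, norm_mul, Complex.norm_real, Real.norm_of_nonneg (Real.exp_pos _).le]

theorem toLp_surjective (α : ℝ) : Function.Surjective (toLp α) := by
  intro f
  have hf : Summable fun n : ℕ => ‖f n‖ := by
    simpa using (lp.memℓp f).summable (by simp)
  refine ⟨⟨fun n => f n * (Real.exp (-(α * n)) : ℂ), ?_⟩, ?_⟩
  · refine hf.congr fun n => ?_
    rw [norm_mul, Complex.norm_real, Real.norm_of_nonneg (Real.exp_pos _).le, mul_assoc,
      ← Real.exp_add]
    simp
  · refine lp.ext (funext fun n => ?_)
    change f n * (Real.exp (-(α * n)) : ℂ) * (Real.exp (α * n) : ℂ) = f n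
    rw [mul_assoc, ← Complex.ofReal_mul, ← Real.exp_add]
    simp

/-- Needed both for the operator exponential and for the limit of the truncated solutions. -/
instance instCompleteSpace (α : ℝ) : CompleteSpace (WeightedL1 α) :=
  ((IsometryEquiv.mk (Equiv.ofBijective (toLp α)
    ⟨(toLp_isometry α).injective, toLp_surjective α⟩) (toLp_isometry α)).completeSpace_iff).2
    inferInstance

/-! ### Matrices acting through their columns. -/

/-- The columns of `m` lie in `E_β` with norm at most `K * exp (γ * k)`. -/
def ColBound (m : ℕ → ℕ → ℂ) (γ β K : ℝ) : Prop :=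
  ∀ k : ℕ, (Summable fun n : ℕ => ‖m n k‖ * Real.exp (β * n)) ∧
    ∑' n : ℕ, ‖m n k‖ * Real.exp (β * n) ≤ K * Real.exp (γ * k)

/-- On an `ℓ¹` space an operator is controlled by the images of the unit vectors: `∑ u k • col k`
converges absolutely, and coordinates are continuous. -/
theorem ColBound.exists_apply {m : ℕ → ℕ → ℂ} {γ β K : ℝ} (hm : ColBound m γ β K)
    (u : WeightedL1 γ) :
    ∃ v : WeightedL1 β, (∀ n, HasSum (fun k => m n k * u k) (v n)) ∧ ‖v‖ ≤ K * ‖u‖ := by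
  let col : ℕ → WeightedL1 β := fun k => ⟨fun n => m n k, (hm k).1⟩
  have hcol : ∀ k, ‖col k‖ ≤ K * Real.exp (γ * k) := fun k => (hm k).2
  have hle : ∀ k, ‖u k • col k‖ ≤ K * (‖u k‖ * Real.exp (γ * k)) := fun k => by
    rw [norm_smul, mul_left_comm]
    exact mul_le_mul_of_nonneg_left (hcol k) (norm_nonneg _)
  have hs : HasSum (fun k => K * (‖u k‖ * Real.exp (γ * k))) (K * ‖u‖) :=
    u.summable.hasSum.mul_left K
  have hsum : Summable fun k => u k • col k := Summable.of_norm_bounded hs.summable hle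
  refine ⟨∑' k, u k • col k, fun n => ?_, tsum_of_norm_bounded hs hle⟩
  refine (hsum.hasSum.mapL (coordCLM β n)).congr_fun fun k => ?_
  rw [coordCLM_apply, smul_apply, mul_comm]

theorem ColBound.norm_le {m : ℕ → ℕ → ℂ} {γ β K : ℝ} (hm : ColBound m γ β K)
    {u : WeightedL1 γ} {v : WeightedL1 β} (hv : ∀ n, HasSum (fun k => m n k * u k) (v n)) :
    ‖v‖ ≤ K * ‖u‖ := by
  obtain ⟨v', h, hn⟩ := hm.exists_apply u
  rwa [show v = v' from ext fun n => (hv n).unique (h n)]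

/-! ### Dissipativity and the comparison principle. -/

/-- Write `w - h • y = (1 + h d) w - h b w`. The first term has norm exactly `‖w‖ + h ‖d w‖`, and
`‖b w‖ ≤ ‖d w‖` because `b w = (b / d) (d w)` and the columns of `b / d` have weighted norm at most
one. -/
theorem le_norm_sub_smul {d : ℕ → ℝ} {b : ℕ → ℕ → ℂ} {β : ℝ} (hd : ∀ n, 0 ≤ d n)
    (hb : ∀ k : ℕ, (Summable fun n : ℕ => ‖b n k‖ * Real.exp (β * n)) ∧
      ∑' n : ℕ, ‖b n k‖ * Real.exp (β * n) ≤ d k * Real.exp (β * k))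
    {w y : WeightedL1 β} (hdw : Summable fun n : ℕ => d n * (‖w n‖ * Real.exp (β * n)))
    (hy : ∀ n, HasSum (fun k => (-(if n = k then (d n : ℂ) else 0) + b n k) * w k) (y n))
    {h : ℝ} (hh : 0 ≤ h) : ‖w‖ ≤ ‖w - h • y‖ := by
  have hdw' : Summable fun n : ℕ => ‖(d n : ℂ) * w n‖ * Real.exp (β * n) :=
    hdw.congr fun n => by
      rw [norm_mul, Complex.norm_real, Real.norm_of_nonneg (hd n), mul_assoc]
  let dw : WeightedL1 β := ⟨fun n => (d n : ℂ) * w n, hdw'⟩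
  have hB : ColBound (fun n k => b n k / (d k : ℂ)) β β 1 := by
    intro k
    have he : (fun n : ℕ => ‖b n k / (d k : ℂ)‖ * Real.exp (β * n)) =
        fun n : ℕ => (‖b n k‖ * Real.exp (β * n)) / d k := by
      funext n
      rw [norm_div, Complex.norm_real, Real.norm_of_nonneg (hd k), div_mul_eq_mul_div]
    rw [he]
    refine ⟨(hb k).1.div_const _, ?_⟩
    rw [tsum_div_const, one_mul]
    exact div_le_of_le_mul₀ (hd k) (Real.exp_pos _).le (by rw [mul_comm]; exact (hb k).2)
  have hbd : ∀ n k, b n k / (d k : ℂ) * dw k = b n k * w k := by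
    intro n k
    change b n k / (d k : ℂ) * ((d k : ℂ) * w k) = _
    rcases (hd k).eq_or_lt with h0 | h0
    -- `d k = 0` occurs for truncated matrices; column `k` of `b` then vanishes, so Lean's division
    -- by zero is harmless.
    · have h1 : HasSum (fun n : ℕ => ‖b n k‖ * Real.exp (β * n)) 0 := by
        have h2 : ∑' n : ℕ, ‖b n k‖ * Real.exp (β * n) = 0 :=
          le_antisymm (by simpa [← h0] using (hb k).2) (tsum_nonneg fun n => by positivity)
        exact h2 ▸ (hb k).1.hasSum
      rw [hasSum_zero_iff_of_nonneg fun n => by positivity] at h1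
      have h3 : b n k = 0 := by simpa [(Real.exp_pos _).ne'] using congrFun h1 n
      simp [h3]
    · have : (d k : ℂ) ≠ 0 := by exact_mod_cast h0.ne'
      field_simp
  obtain ⟨z, hz, hzn⟩ := hB.exists_apply dw
  simp only [hbd] at hz
  have hyz : ∀ n, y n = -((d n : ℂ) * w n) + z n := by
    intro n
    refine (hy n).unique ?_
    have h1 : HasSum (fun k => -(if n = k then (d n : ℂ) else 0) * w k) (-((d n : ℂ) * w n)) := by
      have h2 := hasSum_ite_eq n (-((d n : ℂ) * w n))
      refine h2.congr_fun fun k => ?_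
      by_cases hk : k = n
      · subst hk; simp
      · simp [hk, Ne.symm hk]
    exact (h1.add (hz n)).congr_fun fun k => by ring
  have h1 : ‖w‖ + h * ‖dw‖ = ‖w + h • dw‖ := by
    rw [norm_def (w + h • dw), norm_def w, norm_def dw, ← tsum_mul_left,
      ← Summable.tsum_add w.summable (dw.summable.mul_left h)]
    refine tsum_congr fun n => ?_
    have h2 : (w + h • dw) n = ((1 + h * d n : ℝ) : ℂ) * w n := by
      rw [add_apply, real_smul_apply]
      change w n + h * ((d n : ℂ) * w n) = _
      push_cast; ring
    have h3 : dw n = (d n : ℂ) * w n := rfl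
    have := hd n
    rw [h2, h3, norm_mul, norm_mul, Complex.norm_real, Complex.norm_real,
      Real.norm_of_nonneg this, Real.norm_of_nonneg (by positivity)]
    ring
  have h2 : w - h • y = (w + h • dw) - h • z := by
    ext n
    simp only [sub_apply, add_apply, real_smul_apply, hyz]
    change _ = w n + h * ((d n : ℂ) * w n) - _
    ring
  have h3 : ‖h • z‖ ≤ h * ‖dw‖ := by
    rw [norm_smul, Real.norm_of_nonneg hh]
    exact mul_le_mul_of_nonneg_left (by simpa using hzn) hh
  have h4 := norm_sub_norm_le (w + h • dw) (h • z)
  rw [h2]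
  linarith

end WeightedL1

/-- A comparison principle for `w' = A w + g` with `A` dissipative. -/
theorem norm_le_of_dissipative {E : Type*} [NormedAddCommGroup E] [NormedSpace ℝ E]
    {w y g : ℝ → E} {B B' : ℝ → ℝ} {t : ℝ} (ht : 0 ≤ t)
    (hw : ∀ s ∈ Set.Icc 0 t, HasDerivWithinAt w (y s) (Set.Icc 0 t) s)
    (hdis : ∀ s ∈ Set.Icc 0 t, ∀ h : ℝ, 0 ≤ h → ‖w s‖ ≤ ‖w s - h • (y s - g s)‖)
    (hg : ∀ s ∈ Set.Icc 0 t, ‖g s‖ ≤ B' s)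
    (hB : ∀ s ∈ Set.Icc 0 t, HasDerivAt B (B' s) s) (h0 : ‖w 0‖ ≤ B 0) : ‖w t‖ ≤ B t := by
  -- Dissipativity compares `w s` with the earlier value `w (s - h)`, hence controls left slopes,
  -- while the mean value lemma asks for right slopes. Time is therefore reversed and the lemma
  -- applied to `-‖w (t - s)‖`.
  have hmaps : Set.MapsTo (fun s => t - s) (Set.Icc 0 t) (Set.Icc 0 t) := fun s hs =>
    ⟨by linarith [hs.2], by linarith [hs.1]⟩
  have hwc : ContinuousOn w (Set.Icc 0 t) := fun s hs => (hw s hs).continuousWithinAt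
  have hBc : ContinuousOn B (Set.Icc 0 t) := fun s hs => (hB s hs).continuousAt.continuousWithinAt
  have hBr : ∀ s ∈ Set.Icc 0 t, HasDerivAt (fun s => -‖w t‖ + B t - B (t - s)) (B' (t - s)) s := by
    intro s hs
    have h1 := (hB _ (hmaps hs)).comp s ((hasDerivAt_id s).const_sub t)
    have h2 := h1.const_sub (-‖w t‖ + B t)
    simpa [Function.comp_def] using h2
  have key := image_le_of_liminf_slope_right_le_deriv_boundary
    (f := fun s => -‖w (t - s)‖) (a := 0) (b := t)
    (B := fun s => -‖w t‖ + B t - B (t - s)) (B' := fun s => B' (t - s))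
    ((hwc.comp (by fun_prop) hmaps).norm.neg) (by simp)
    (fun s hs => (hBr s hs).continuousAt.continuousWithinAt)
    (fun s hs => (hBr s (Set.Ico_subset_Icc_self hs)).hasDerivWithinAt) ?_
    (Set.right_mem_Icc.2 ht)
  · simp only [sub_self] at key
    linarith
  intro s hs r hr
  have hs' : s ∈ Set.Icc 0 t := Set.Ico_subset_Icc_self hs
  have hgp := hg _ (hmaps hs')
  have hε : 0 < r - B' (t - s) := by linarith
  have ho := (hasDerivWithinAt_iff_isLittleO.1 (hw _ (hmaps hs'))).bound (half_pos hε)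
  have htend : Tendsto (fun z => t - z) (𝓝[>] s) (𝓝[Set.Icc 0 t] (t - s)) := by
    refine tendsto_nhdsWithin_iff.2 ⟨?_, ?_⟩
    · exact ((continuous_const.sub continuous_id).tendsto s).mono_left nhdsWithin_le_nhds
    · filter_upwards [Ioo_mem_nhdsGT hs.2] with z hz
      exact ⟨by linarith [hz.2], by linarith [hz.1, hs.1]⟩
  refine Eventually.frequently ?_
  filter_upwards [htend.eventually ho, self_mem_nhdsWithin] with z hz hsz
  have hsz : s < z := hsz
  set p := t - s with hp
  have hpz : t - z - p = -(z - s) := by rw [hp]; ring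
  have hzs : 0 < z - s := by linarith
  rw [hpz, norm_neg, Real.norm_of_nonneg hzs.le] at hz
  have h1 := hdis p (hmaps hs') (z - s) hzs.le
  have h2 : w p - (z - s) • (y p - g p) =
      w (t - z) - (w (t - z) - w p - (-(z - s)) • y p) + (z - s) • g p := by
    rw [smul_sub, neg_smul]; abel
  have h3 : ‖(z - s) • g p‖ ≤ (z - s) * B' p := by
    rw [norm_smul, Real.norm_of_nonneg hzs.le]
    exact mul_le_mul_of_nonneg_left hgp hzs.le
  have h4 : ‖w p‖ ≤ ‖w (t - z)‖ + (r - B' p) / 2 * (z - s) + (z - s) * B' p := by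
    rw [h2] at h1
    refine h1.trans ((norm_add_le _ _).trans (add_le_add ((norm_sub_le _ _).trans ?_) h3))
    linarith
  rw [slope_def_field, div_lt_iff₀ hzs]
  nlinarith

/-! ### Matrices on the scale and their column truncations. -/

/-- A matrix `-d + b + c` with `b` dominated by `d`, `d` of subexponential growth and `c` losing
regularity with the constant `M`, in the scale `(E_β)` with `αs < β ≤ top`. -/
structure ScaleMatrix (αs top M : ℝ) (d : ℕ → ℝ) (b c : ℕ → ℕ → ℂ) : Prop where
  M_pos : 0 < M
  d_nonneg : ∀ n, 0 ≤ d n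
  b_col : ∀ β, αs < β → ∀ k : ℕ, (Summable fun n : ℕ => ‖b n k‖ * Real.exp (β * n)) ∧
    ∑' n : ℕ, ‖b n k‖ * Real.exp (β * n) ≤ d k * Real.exp (β * k)
  d_growth : ∀ ν, 0 < ν → ∃ K, ∀ n : ℕ, d n ≤ K * Real.exp (ν * n)
  c_col : ∀ β γ, αs < β → β < γ → γ ≤ top → ColBound c γ β (M / (γ - β))

/-- The matrix `-d + b + c`. -/
def fullMatrix (d : ℕ → ℝ) (b c : ℕ → ℕ → ℂ) (n k : ℕ) : ℂ :=
  -(if n = k then (d n : ℂ) else 0) + b n k + c n k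

/-- The matrix that agrees with `m` in the first `N` columns and vanishes elsewhere. -/
def truncCols (N : ℕ) (m : ℕ → ℕ → ℂ) (n k : ℕ) : ℂ := if k < N then m n k else 0

/-- A truncated system has the same form, so every estimate applies to it with the same `M`. The
price is a diagonal that may vanish. -/
theorem truncCols_fullMatrix (N : ℕ) (d : ℕ → ℝ) (b c : ℕ → ℕ → ℂ) :
    truncCols N (fullMatrix d b c) =
      fullMatrix (fun n => if n < N then d n else 0) (truncCols N b) (truncCols N c) := by
  funext n k
  by_cases hk : k < N
  · by_cases hn : n = k
    · subst hn; simp [truncCols, fullMatrix, hk]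
    · simp [truncCols, fullMatrix, hk, hn]
  · by_cases hn : n = k
    · subst hn; simp [truncCols, fullMatrix, hk]
    · simp [truncCols, fullMatrix, hk, hn]

namespace WeightedL1

theorem ColBound.truncCols {m : ℕ → ℕ → ℂ} {γ β K : ℝ} (hm : ColBound m γ β K) (hK : 0 ≤ K)
    (N : ℕ) : ColBound (truncCols N m) γ β K := by
  intro k
  by_cases hk : k < N
  · simpa [_root_.truncCols, hk] using hm k
  · simpa [_root_.truncCols, hk, summable_zero] using mul_nonneg hK (Real.exp_pos _).le

/-- The columns beyond the `N`-th one are small in a weaker norm. -/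
theorem ColBound.tail {m m' : ℕ → ℕ → ℂ} {γ β K ν : ℝ} (hm : ColBound m γ β K) (hK : 0 ≤ K)
    (hν : 0 ≤ ν) {N : ℕ} (h0 : ∀ n k, k < N → m' n k = 0) (h1 : ∀ n k, ‖m' n k‖ ≤ ‖m n k‖) :
    ColBound m' (γ + ν) β (K * Real.exp (-ν * N)) := by
  intro k
  have hs : Summable fun n : ℕ => ‖m' n k‖ * Real.exp (β * n) :=
    Summable.of_nonneg_of_le (fun n => by positivity)
      (fun n => mul_le_mul_of_nonneg_right (h1 n k) (Real.exp_pos _).le) (hm k).1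
  refine ⟨hs, ?_⟩
  by_cases hk : k < N
  · simp only [h0 _ _ hk, norm_zero, zero_mul, tsum_zero]
    positivity
  · refine (hs.tsum_le_tsum
      (fun n => mul_le_mul_of_nonneg_right (h1 n k) (Real.exp_pos _).le) (hm k).1).trans
      ((hm k).2.trans ?_)
    rw [mul_assoc, ← Real.exp_add]
    have hk' : (N : ℝ) ≤ k := by exact_mod_cast not_lt.1 hk
    gcongr
    nlinarith [mul_nonneg hν (sub_nonneg.2 hk')]

end WeightedL1

namespace ScaleMatrix

variable {αs top M : ℝ} {d : ℕ → ℝ} {b c : ℕ → ℕ → ℂ}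

theorem mono_top (h : ScaleMatrix αs top M d b c) {top' : ℝ} (ht : top' ≤ top) :
    ScaleMatrix αs top' M d b c :=
  { h with c_col := fun β γ h1 h2 h3 => h.c_col β γ h1 h2 (h3.trans ht) }

theorem trunc (h : ScaleMatrix αs top M d b c) (N : ℕ) :
    ScaleMatrix αs top M (fun n => if n < N then d n else 0) (truncCols N b) (truncCols N c) where
  M_pos := h.M_pos
  d_nonneg n := by
    split_ifs
    exacts [h.d_nonneg n, le_rfl]
  b_col β hβ k := by
    by_cases hk : k < N
    · simpa [truncCols, hk] using h.b_col β hβ k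
    · simp [truncCols, hk, summable_zero]
  d_growth ν hν := by
    obtain ⟨K, hK⟩ := h.d_growth ν hν
    refine ⟨K, fun n => ?_⟩
    split_ifs
    exacts [hK n, (h.d_nonneg n).trans (hK n)]
  c_col β γ h1 h2 h3 :=
    (h.c_col β γ h1 h2 h3).truncCols (div_nonneg h.M_pos.le (sub_nonneg.2 h2.le)) N

theorem summable_d_mul (h : ScaleMatrix αs top M d b c) {β γ : ℝ} (hβγ : β < γ)
    (w : WeightedL1 γ) : Summable fun n : ℕ => d n * (‖w n‖ * Real.exp (β * n)) := by
  obtain ⟨K, hK⟩ := h.d_growth (γ - β) (sub_pos.2 hβγ)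
  refine Summable.of_nonneg_of_le (fun n => mul_nonneg (h.d_nonneg n) (by positivity))
    (fun n => ?_) (w.summable.mul_left K)
  calc d n * (‖w n‖ * Real.exp (β * n))
      ≤ (K * Real.exp ((γ - β) * n)) * (‖w n‖ * Real.exp (β * n)) := by gcongr; exact hK n
    _ = K * (‖w n‖ * (Real.exp ((γ - β) * n) * Real.exp (β * n))) := by ring
    _ = _ := by rw [← Real.exp_add]; ring_nf

/-- The full matrix maps `E_{β+ν}` to `E_β`, uniformly in `β`. -/
theorem exists_colBound (h : ScaleMatrix αs top M d b c) {ν : ℝ} (hν : 0 < ν) :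
    ∃ K, 0 ≤ K ∧ ∀ β, αs < β → β + ν ≤ top → ColBound (fullMatrix d b c) (β + ν) β K := by
  obtain ⟨K, hK⟩ := h.d_growth ν hν
  have hK0 : 0 ≤ K := by simpa using (h.d_nonneg 0).trans (hK 0)
  have hM := h.M_pos
  -- One `K` for the diagonal, one for `b`, which it dominates, and `M / ν` for `c`.
  refine ⟨2 * K + M / ν, by positivity, fun β hβ ht k => ?_⟩
  have hc := h.c_col β (β + ν) hβ (by linarith) ht k
  rw [add_sub_cancel_left] at hc
  have hb := h.b_col β hβ k
  have hd : HasSum (fun n : ℕ => ‖if n = k then (d n : ℂ) else 0‖ * Real.exp (β * n))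
      (d k * Real.exp (β * k)) := by
    refine (hasSum_ite_eq k (d k * Real.exp (β * k))).congr_fun fun n => ?_
    by_cases hn : n = k
    · subst hn; simp [abs_of_nonneg (h.d_nonneg n)]
    · simp [hn]
  have hle : ∀ n : ℕ, ‖fullMatrix d b c n k‖ * Real.exp (β * n) ≤
      ‖if n = k then (d n : ℂ) else 0‖ * Real.exp (β * n) + ‖b n k‖ * Real.exp (β * n) +
        ‖c n k‖ * Real.exp (β * n) := fun n => by
    rw [← add_mul, ← add_mul]
    refine mul_le_mul_of_nonneg_right ?_ (Real.exp_pos _).le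
    refine (norm_add₃_le ..).trans ?_
    rw [norm_neg]
  have hs := (hd.summable.add hb.1).add hc.1
  have hs' := Summable.of_nonneg_of_le (fun n => by positivity) hle hs
  refine ⟨hs', (hs'.tsum_le_tsum hle hs).trans ?_⟩
  rw [(hd.summable.add hb.1).tsum_add hc.1, hd.summable.tsum_add hb.1, hd.tsum_eq]
  have h1 : d k * Real.exp (β * k) ≤ K * Real.exp ((β + ν) * k) := by
    calc d k * Real.exp (β * k) ≤ K * Real.exp (ν * k) * Real.exp (β * k) := by
          gcongr; exact hK k
      _ = _ := by rw [mul_assoc, ← Real.exp_add]; ring_nf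
  linarith [hb.2, hc.2]

/-- The columns of the full matrix lie in every `E_β`. -/
theorem exists_colBound_truncCols (h : ScaleMatrix αs top M d b c) {β : ℝ}
    (hc : ∀ k : ℕ, Summable fun n : ℕ => ‖c n k‖ * Real.exp (β * n)) (hβ : αs < β) (N : ℕ) :
    ∃ K, ColBound (truncCols N (fullMatrix d b c)) β β K := by
  have hs : ∀ k, Summable fun n : ℕ => ‖fullMatrix d b c n k‖ * Real.exp (β * n) := by
    intro k
    have hd : Summable (fun n : ℕ => ‖if n = k then (d n : ℂ) else 0‖ * Real.exp (β * n)) :=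
      summable_of_ne_finset_zero (s := {k}) fun n hn => by
        simp [show n ≠ k by simpa using hn]
    refine Summable.of_nonneg_of_le (fun n => by positivity) (fun n => ?_)
      ((hd.add (h.b_col β hβ k).1).add (hc k))
    rw [← add_mul, ← add_mul]
    refine mul_le_mul_of_nonneg_right ?_ (Real.exp_pos _).le
    refine (norm_add₃_le ..).trans ?_
    rw [norm_neg]
  let S : ℕ → ℝ := fun k => ∑' n : ℕ, ‖fullMatrix d b c n k‖ * Real.exp (β * n)
  have hS : ∀ k, 0 ≤ S k * Real.exp (-(β * k)) := fun k =>
    mul_nonneg (tsum_nonneg fun n => by positivity) (Real.exp_pos _).le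
  refine ⟨∑ k ∈ Finset.range N, S k * Real.exp (-(β * k)), fun k => ?_⟩
  by_cases hk : k < N
  · simp only [truncCols, hk, if_true]
    refine ⟨hs k, ?_⟩
    have h1 := Finset.single_le_sum (fun j _ => hS j) (Finset.mem_range.2 hk)
    calc S k = S k * Real.exp (-(β * k)) * Real.exp (β * k) := by
          rw [mul_assoc, ← Real.exp_add]; simp
      _ ≤ _ := by gcongr
  · simpa [truncCols, hk, summable_zero] using
      mul_nonneg (Finset.sum_nonneg fun j _ => hS j) (Real.exp_pos _).le

/-! ### The a priori estimate. -/

/-- An evolution `w' = A w + f` in the scale of spaces below `E_top`. -/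
structure Evolves (αs a τ ε : ℝ) (m : ℕ → ℕ → ℂ) {top : ℝ} (w : ℝ → WeightedL1 top) : Prop where
  deriv : ∀ β, αs < β → ∀ hβ : β < top, ∀ s, 0 ≤ s → s < τ → s < a * (top - β) →
    ∃ y f : WeightedL1 β,
      HasDerivWithinAt (fun t => embed hβ.le (w t)) y (Set.Ico 0 τ) s ∧
      (∀ n, HasSum (fun k => m n k * w s k) (y n - f n)) ∧ ‖f‖ ≤ ε

/-- The weight `γ` puts `a * (top - γ)` midway between `s` and `a * (top - β)`: time `s` is still
admissible for `γ`, and both gaps are proportional to `a * (top - β) - s`. -/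
theorem exists_intermediate_weight {a β top s : ℝ} (ha : 0 < a) (hs : 0 ≤ s)
    (h : s < a * (top - β)) : ∃ γ, β < γ ∧ γ < top ∧
      a * (top - γ) = (a * (top - β) + s) / 2 ∧ γ - β = (a * (top - β) - s) / (2 * a) := by
  have hsa : s / a < top - β := by rw [div_lt_iff₀ ha]; linarith
  have hsa0 : 0 ≤ s / a := div_nonneg hs ha.le
  refine ⟨(β + top - s / a) / 2, by linarith, by linarith, ?_, ?_⟩
  · field_simp
    ring
  · field_simp
    ring

/-- The left side is the loss caused by `c` times the growth bound at the intermediate weight. Since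
`D + s < 2 * D`, it is at most a multiple of `D / (D - s) ^ 2`, the `s`-derivative of `D / (D - s)`;
integration thus reproduces the original weight. -/
theorem intermediate_weight_bound {a M Φ D s : ℝ} (ha : 0 < a) (hM : 0 ≤ M) (hΦ : 0 ≤ Φ)
    (h : s < D) :
    M / ((D - s) / (2 * a)) * (Φ * ((D + s) / 2 / ((D + s) / 2 - s))) ≤
      4 * a * M * Φ * (D / (D - s) ^ 2) := by
  have e0 : 0 < D - s := sub_pos.2 h
  have e3 : M / ((D - s) / (2 * a)) * (Φ * ((D + s) / 2 / ((D + s) / 2 - s))) =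
      2 * a * M * Φ * ((D + s) / (D - s) ^ 2) := by
    rw [show (D + s) / 2 - s = (D - s) / 2 by ring]
    have := e0.ne'
    field_simp
  have e4 : 4 * a * M * Φ * (D / (D - s) ^ 2) = 2 * a * M * Φ * ((2 * D) / (D - s) ^ 2) := by
    ring
  rw [e3, e4]
  gcongr
  linarith

/-- Treat `c w` as forcing of the dissipative part: bound it in `E_β` through the assumed estimate
at the intermediate weight, then integrate by the comparison principle. -/
theorem apriori_step (h : ScaleMatrix αs top M d b c) {a τ ε X Φ : ℝ} (ha : 0 < a) (hε : 0 ≤ ε)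
    (hΦ : 0 ≤ Φ) {w : ℝ → WeightedL1 top} (hw : Evolves αs a τ ε (fullMatrix d b c) w)
    (hX : ‖w 0‖ + ε * τ ≤ X)
    (hb : ∀ β, αs < β → ∀ hβ : β < top, ∀ s, 0 ≤ s → s < τ → s < a * (top - β) →
      ‖embed hβ.le (w s)‖ ≤ Φ * (a * (top - β) / (a * (top - β) - s))) :
    ∀ β, αs < β → ∀ hβ : β < top, ∀ s, 0 ≤ s → s < τ → s < a * (top - β) →
      ‖embed hβ.le (w s)‖ ≤ (X + 4 * a * M * Φ) * (a * (top - β) / (a * (top - β) - s)) := by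
  intro β hαβ hβ t ht0 htτ htδ
  set δ := top - β with hδ
  have hδ0 : 0 < δ := sub_pos.2 hβ
  have hM := h.M_pos
  have haδ : 0 < a * δ := mul_pos ha hδ0
  have hpos : ∀ s ∈ Set.Icc 0 t, 0 < a * δ - s := fun s hs => by linarith [hs.2]
  have hsub : Set.Icc 0 t ⊆ Set.Ico 0 τ := fun s hs => ⟨hs.1, hs.2.trans_lt htτ⟩
  have hex : ∀ s, ∃ y g : WeightedL1 β, s ∈ Set.Icc 0 t →
      HasDerivWithinAt (fun t => embed hβ.le (w t)) y (Set.Icc 0 t) s ∧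
      (∀ r : ℝ, 0 ≤ r → ‖embed hβ.le (w s)‖ ≤ ‖embed hβ.le (w s) - r • (y - g)‖) ∧
      ‖g‖ ≤ ε + 4 * a * M * Φ * (a * δ / (a * δ - s) ^ 2) := by
    intro s
    by_cases hs : s ∈ Set.Icc 0 t
    swap
    · exact ⟨0, 0, fun h => absurd h hs⟩
    have hps := hpos s hs
    obtain ⟨y, f, hy, hsum, hf⟩ := hw.deriv β hαβ hβ s hs.1 (hsub hs).2 (by linarith)
    obtain ⟨γ, hβγ, hγt, e1, e2⟩ := exists_intermediate_weight ha hs.1 (sub_pos.1 hps)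
    have hwγ := hb γ (hαβ.trans hβγ) hγt s hs.1 (hsub hs).2 (by rw [e1]; linarith)
    obtain ⟨v, hv, hvn⟩ := (h.c_col β γ hαβ hβγ hγt.le).exists_apply (embed hγt.le (w s))
    -- With `v = c w`, subtracting `v + f` from the derivative leaves exactly `(-d + b) w`.
    refine ⟨y, v + f, fun _ => ⟨hy.mono hsub, fun r hr => ?_, ?_⟩⟩
    · have hsd : Summable fun n : ℕ => d n * (‖embed hβ.le (w s) n‖ * Real.exp (β * n)) :=
        h.summable_d_mul hβ (w s)
      refine le_norm_sub_smul h.d_nonneg (h.b_col β hαβ) hsd (fun n => ?_) hr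
      have := (hsum n).sub (hv n)
      rw [sub_apply, add_apply, show y n - (v n + f n) = y n - f n - v n by ring]
      refine this.congr_fun fun k => ?_
      simp only [fullMatrix, embed_apply]
      ring
    · have h1 : ‖v‖ ≤ 4 * a * M * Φ * (a * δ / (a * δ - s) ^ 2) := by
        have h2 : M / (γ - β) * ‖embed hγt.le (w s)‖ ≤
            M / (γ - β) * (Φ * (a * (top - γ) / (a * (top - γ) - s))) :=
          mul_le_mul_of_nonneg_left hwγ (div_nonneg hM.le (by linarith))
        refine (hvn.trans h2).trans ?_
        rw [e1, e2]
        exact intermediate_weight_bound ha hM.le hΦ (sub_pos.1 hps)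
      linarith [norm_add_le v f]
  choose y g hyg using hex
  have hfin := norm_le_of_dissipative (w := fun t => embed hβ.le (w t)) (y := y) (g := g)
    (B := fun s => ‖w 0‖ + ε * s + 4 * a * M * Φ * (a * δ / (a * δ - s)))
    (B' := fun s => ε + 4 * a * M * Φ * (a * δ / (a * δ - s) ^ 2)) ht0
    (fun s hs => (hyg s hs).1) (fun s hs => (hyg s hs).2.1) (fun s hs => (hyg s hs).2.2)
    (fun s hs => ?_) ?_
  · refine hfin.trans ?_
    have h1 : 1 ≤ a * δ / (a * δ - t) := by
      rw [one_le_div (by linarith)]; linarith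
    have h2 : ‖w 0‖ + ε * t ≤ X := by nlinarith
    have h3 : 0 ≤ X := by nlinarith [norm_nonneg (w 0)]
    rw [add_mul]
    gcongr
    nlinarith
  · have h1 : HasDerivAt (fun s => a * δ - s) (-1) s := (hasDerivAt_id s).const_sub _
    have h2 := ((h1.inv (hpos s hs).ne').const_mul (a * δ)).const_mul (4 * a * M * Φ)
    have h3 := ((hasDerivAt_id s).const_mul ε).const_add ‖w 0‖
    refine (h3.add h2).congr_deriv ?_ |>.congr_of_eventuallyEq ?_
    · field_simp
    · exact Eventually.of_forall fun z => by simp [div_eq_mul_inv]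
  · have h1 : (0 : ℝ) ≤ 4 * a * M * Φ * (a * δ / (a * δ - 0)) := by
      rw [sub_zero]; positivity
    have := norm_embed_le hβ.le (w 0)
    linarith

/-- The a priori bound of Ovsyannikov–Nishida type. -/
theorem apriori (h : ScaleMatrix αs top M d b c) {a τ ε X K : ℝ} (ha : 0 < a)
    (haM : 4 * a * M < 1) (hε : 0 ≤ ε) (hτ : 0 ≤ τ)
    {w : ℝ → WeightedL1 top} (hw : Evolves αs a τ ε (fullMatrix d b c) w)
    (hX : ‖w 0‖ + ε * τ ≤ X) (hK : ∀ s, 0 ≤ s → s < τ → ‖w s‖ ≤ K) :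
    ∀ β, αs < β → ∀ hβ : β < top, ∀ s, 0 ≤ s → s < τ → s < a * (top - β) →
      ‖embed hβ.le (w s)‖ ≤ X / (1 - 4 * a * M) * (a * (top - β) / (a * (top - β) - s)) := by
  have hM := h.M_pos
  set θ := 4 * a * M with hθ
  have hθ0 : 0 ≤ θ := by positivity
  have hX0 : 0 ≤ X := by nlinarith [norm_nonneg (w 0)]
  -- `X / (1 - θ)` is the fixed point of `Φ ↦ X + θ * Φ`. The crude bound `K` only starts the
  -- iteration and disappears geometrically.
  have hit : ∀ j : ℕ, ∀ β, αs < β → ∀ hβ : β < top, ∀ s, 0 ≤ s → s < τ → s < a * (top - β) →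
      ‖embed hβ.le (w s)‖ ≤
        (X / (1 - θ) + θ ^ j * |K|) * (a * (top - β) / (a * (top - β) - s)) := by
    intro j
    induction j with
    | zero =>
      intro β _ hβ s h0 hs hsδ
      have h1 : 1 ≤ a * (top - β) / (a * (top - β) - s) := by
        rw [one_le_div (by linarith)]; linarith
      have h2 : 0 ≤ X / (1 - θ) := div_nonneg hX0 (by linarith)
      have h3 := (norm_embed_le hβ.le (w s)).trans ((hK s h0 hs).trans (le_abs_self K))
      have h4 := abs_nonneg K
      rw [pow_zero, one_mul]
      nlinarith
    | succ j ih =>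
      have h2 : 0 ≤ X / (1 - θ) := div_nonneg hX0 (by linarith)
      have key := h.apriori_step ha hε (by positivity) hw hX ih
      have e : X + θ * (X / (1 - θ) + θ ^ j * |K|) = X / (1 - θ) + θ ^ (j + 1) * |K| := by
        have : 1 - θ ≠ 0 := by linarith
        field_simp
        ring
      rwa [← hθ, e] at key
  intro β hαβ hβ s h0 hs hsδ
  have hlim : Tendsto (fun j : ℕ => (X / (1 - θ) + θ ^ j * |K|) *
      (a * (top - β) / (a * (top - β) - s))) atTop
      (𝓝 ((X / (1 - θ) + 0 * |K|) * (a * (top - β) / (a * (top - β) - s)))) :=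
    (((tendsto_pow_atTop_nhds_zero_of_lt_one hθ0 haM).mul_const _).const_add _).mul_const _
  have := ge_of_tendsto' hlim fun j => hit j β hαβ hβ s h0 hs hsδ
  simpa using this

end ScaleMatrix

/-! ### Uniqueness. -/

theorem hasDerivWithinAt_embed {α β : ℝ} (h : β ≤ α) {w : ℝ → WeightedL1 α} {y : WeightedL1 α}
    {S : Set ℝ} {s : ℝ} (hw : HasDerivWithinAt w y S s) :
    HasDerivWithinAt (fun t => embed h (w t)) (embed h y) S s :=
  ((embedCLM h).restrictScalars ℝ).hasFDerivAt.comp_hasDerivWithinAt s hw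

theorem continuousOn_embed {α β : ℝ} (h : β ≤ α) {w : ℝ → WeightedL1 α}
    {S : Set ℝ} (hw : ContinuousOn w S) : ContinuousOn (fun t => embed h (w t)) S :=
  (embedCLM h).continuous.comp_continuousOn hw

theorem IsClassicalSolution.isScaleSolution {a : ℕ → ℕ → ℂ} {x : ℕ → ℂ} {T αs α : ℝ}
    {u : ℝ → WeightedL1 α} (hu : IsClassicalSolution a x T u) : IsScaleSolution a x T αs u := by
  obtain ⟨u', hc, h⟩ := hu.ode
  exact
    { continuousOn := fun t ht => (h t ht).1.continuousWithinAt
      ode := fun β hβ _ =>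
        { initial := hu.initial
          ode := ⟨fun t => embed hβ.le (u' t), continuousOn_embed _ hc, fun t ht =>
            ⟨hasDerivWithinAt_embed _ (h t ht).1, (h t ht).2⟩⟩ } }

namespace ScaleMatrix

variable {αs top M : ℝ} {d : ℕ → ℝ} {b c : ℕ → ℕ → ℂ}

/-- The a priori bound with `X = 0` kills `w` in a larger space `E_β` for a fixed length of time;
the embedding is injective, so `w` vanishes in `E_top` too and the argument restarts. -/
theorem eq_zero_of_deriv (h : ScaleMatrix αs top M d b c) (ht : αs < top) {T : ℝ}
    {w : ℝ → WeightedL1 top} (hc : ContinuousOn w (Set.Ico 0 T)) (h0 : w 0 = 0)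
    (hw : ∀ β, αs < β → ∀ hβ : β < top, ∀ s ∈ Set.Ico 0 T, ∃ y : WeightedL1 β,
      HasDerivWithinAt (fun t => embed hβ.le (w t)) y (Set.Ico 0 T) s ∧
      ∀ n, HasSum (fun k => fullMatrix d b c n k * w s k) (y n)) :
    ∀ t ∈ Set.Ico 0 T, w t = 0 := by
  have hM := h.M_pos
  -- Any `a < 1 / (4 * M)` would do: only a positive step length matters here.
  set a : ℝ := 1 / (8 * M) with ha_def
  have ha : 0 < a := by positivity
  have haM : 4 * a * M = 1 / 2 := by rw [ha_def]; field_simp; norm_num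
  set β : ℝ := (αs + top) / 2 with hβ_def
  have hαβ : αs < β := by linarith
  have hβt : β < top := by linarith
  set r : ℝ := a * (top - β) / 2 with hr_def
  have hr : 0 < r := by have := sub_pos.2 hβt; positivity
  have hind : ∀ j : ℕ, ∀ t ∈ Set.Ico 0 T, t ≤ j * r → w t = 0 := by
    intro j
    induction j with
    | zero =>
      intro t ht hj
      have : t = 0 := le_antisymm (by simpa using hj) ht.1
      rw [this, h0]
    | succ j ih =>
      intro t ht hj
      by_cases htj : t ≤ j * r
      · exact ih t ht htj
      have htj := (not_le.1 htj).le
      push_cast at hj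
      set t₀ : ℝ := j * r with ht₀
      have ht₀0 : 0 ≤ t₀ := by positivity
      have ht₀T : t₀ < T := htj.trans_lt ht.2
      -- The window ends strictly between `t` and `T`, so `w` is bounded on it by compactness.
      set τ : ℝ := (T + t) / 2 - t₀ with hτ
      have hTt := ht.2
      have hsub : Set.Icc t₀ (t₀ + τ) ⊆ Set.Ico 0 T := fun s hs =>
        ⟨ht₀0.trans hs.1, by linarith [hs.2]⟩
      obtain ⟨K, hK⟩ := isCompact_Icc.exists_bound_of_continuousOn (hc.mono hsub)
      have hev : Evolves αs a τ 0 (fullMatrix d b c) (fun s => w (t₀ + s)) := by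
        refine ⟨fun σ hσ hσt s hs0 hsτ _ => ?_⟩
        obtain ⟨y, hy, hsum⟩ := hw σ hσ hσt (t₀ + s) ⟨by linarith, by linarith⟩
        refine ⟨y, 0, ?_, fun n => by simpa [WeightedL1.zero_apply] using hsum n, by simp⟩
        have hshift : HasDerivWithinAt (fun s => t₀ + s) 1 (Set.Ico 0 τ) s :=
          ((hasDerivAt_id s).const_add t₀).hasDerivWithinAt
        have := hy.scomp s hshift fun z hz => ⟨by linarith [hz.1], by linarith [hz.2]⟩
        simpa [Function.comp_def] using this
      have key := h.apriori (X := 0) (K := K) ha (by rw [haM]; norm_num) le_rfl (by linarith) hev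
        (by simp [ih t₀ ⟨ht₀0, ht₀T⟩ le_rfl])
        (fun s hs0 hsτ => hK _ ⟨by linarith, by linarith⟩) β hαβ hβt (t - t₀) (by linarith)
        (by linarith) (by linarith)
      have hz : embed hβt.le (w t) = 0 := by simpa using key
      exact WeightedL1.ext fun n => congrArg (fun v : WeightedL1 β => v n) hz
  intro t ht
  obtain ⟨j, hj⟩ := exists_nat_ge (t / r)
  exact hind j t ht ((div_le_iff₀ hr).1 hj)

theorem eqOn_of_isScaleSolution (h : ScaleMatrix αs top M d b c) (ht : αs < top) {T : ℝ}
    {x : ℕ → ℂ} {u v : ℝ → WeightedL1 top}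
    (hu : IsScaleSolution (fullMatrix d b c) x T αs u)
    (hv : IsScaleSolution (fullMatrix d b c) x T αs v) : Set.EqOn v u (Set.Ico 0 T) := by
  have hinit : (fun t => v t - u t) 0 = 0 := by
    obtain ⟨β, h1, h2⟩ := exists_between ht
    refine sub_eq_zero.2 (WeightedL1.ext fun n => ?_)
    exact ((hv.ode β h2 h1).initial n).trans ((hu.ode β h2 h1).initial n).symm
  intro t htT
  refine sub_eq_zero.1 (h.eq_zero_of_deriv ht (w := fun t => v t - u t) (hv.continuousOn.sub hu.continuousOn) hinit
    (fun β hαβ hβ s hs => ?_) t htT)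
  obtain ⟨u', -, hu'⟩ := (hu.ode β hβ hαβ).ode
  obtain ⟨v', -, hv'⟩ := (hv.ode β hβ hαβ).ode
  refine ⟨v' s - u' s, (hv' s hs).1.sub (hu' s hs).1, fun n => ?_⟩
  refine (((hv' s hs).2 n).sub ((hu' s hs).2 n)).congr_fun fun k => ?_
  simp only [sub_apply, embed_apply]
  ring

/-! ### Existence: truncated systems and their limit. -/

/-- The systems with finitely many nonzero columns have global solutions. -/
theorem exists_truncated (h : ScaleMatrix αs top M d b c) (ht : αs < top)
    (hc : ∀ k : ℕ, Summable fun n : ℕ => ‖c n k‖ * Real.exp (top * n)) (x : WeightedL1 top)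
    (N : ℕ) : ∃ u y : ℝ → WeightedL1 top, u 0 = x ∧ ∀ t, HasDerivAt u (y t) t ∧
      ∀ n, HasSum (fun k => truncCols N (fullMatrix d b c) n k * u t k) (y t n) := by
  obtain ⟨K, hK⟩ := h.exists_colBound_truncCols hc ht N
  choose A hA hAn using fun u => hK.exists_apply u
  let L : WeightedL1 top →L[ℝ] WeightedL1 top := LinearMap.mkContinuous
    { toFun := A
      map_add' := fun u v => WeightedL1.ext fun n =>
        (hA (u + v) n).unique <| ((hA u n).add (hA v n)).congr_fun fun k => by
          rw [WeightedL1.add_apply]; ring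
      map_smul' := fun r u => WeightedL1.ext fun n =>
        (hA (r • u) n).unique <| ((hA u n).mul_left (r : ℂ)).congr_fun fun k => by
          rw [real_smul_apply]; ring } K hAn
  refine ⟨fun t => NormedSpace.exp (t • L) x, fun t => L (NormedSpace.exp (t • L) x), by simp,
    fun t => ⟨?_, fun n => hA _ n⟩⟩
  have h1 := hasDerivAt_exp_smul_const' (𝕂 := ℝ) L t
  exact h1.clm_apply (hasDerivAt_const t x) |>.congr_deriv (by simp)

end ScaleMatrix

/-- A pointwise limit of functions whose derivatives converge locally uniformly. -/
theorem hasDerivWithinAt_of_tendstoUniformlyOn_Icc {E : Type*} [NormedAddCommGroup E]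
    [NormedSpace ℝ E] {f g : ℕ → ℝ → E} {F G : ℝ → E} {T : ℝ}
    (hf : ∀ N, ∀ t ∈ Set.Ico 0 T, HasDerivWithinAt (f N) (g N t) (Set.Ico 0 T) t)
    (hg : ∀ N, ContinuousOn (g N) (Set.Ico 0 T))
    (hF : ∀ t ∈ Set.Ico 0 T, Tendsto (fun N => f N t) atTop (𝓝 (F t)))
    (hG : ∀ t₀ < T, TendstoUniformlyOn g G atTop (Set.Icc 0 t₀)) :
    ContinuousOn G (Set.Ico 0 T) ∧
      ∀ t ∈ Set.Ico 0 T, HasDerivWithinAt F (G t) (Set.Ico 0 T) t := by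
  have hloc : ∀ s ∈ Set.Ico 0 T, ∃ t₀ < T, s < t₀ := fun s hs => by
    obtain ⟨t₀, h1, h2⟩ := exists_between hs.2
    exact ⟨t₀, h2, h1⟩
  have hnhds : ∀ s t₀, s < t₀ → Set.Icc 0 t₀ ∈ 𝓝[Set.Ico 0 T] s := fun s t₀ hst => by
    filter_upwards [self_mem_nhdsWithin, mem_nhdsWithin_of_mem_nhds (Iio_mem_nhds hst)] with z h1 h2
    exact ⟨h1.1, le_of_lt h2⟩
  have hGc : ContinuousOn G (Set.Ico 0 T) := by
    intro s hs
    obtain ⟨t₀, h1, h2⟩ := hloc s hs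
    have hsub : Set.Icc 0 t₀ ⊆ Set.Ico 0 T := fun z hz => ⟨hz.1, hz.2.trans_lt h1⟩
    have h3 := (hG t₀ h1).continuousOn (Frequently.of_forall fun N => (hg N).mono hsub)
    exact (h3 s ⟨hs.1, h2.le⟩).mono_of_mem_nhdsWithin (hnhds s t₀ h2)
  refine ⟨hGc, fun s hs => ?_⟩
  obtain ⟨t₀, h1, h2⟩ := hloc s hs
  rw [hasDerivWithinAt_iff_isLittleO, Asymptotics.isLittleO_iff]
  intro ε hε
  have hcs := Metric.continuousWithinAt_iff'.1 (hGc s hs) (ε / 2) (half_pos hε)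
  obtain ⟨ρ, hρ, hball⟩ := Metric.mem_nhdsWithin_iff.1 (inter_mem hcs (hnhds s t₀ h2))
  have hconv : Convex ℝ (Metric.ball s ρ ∩ Set.Ico 0 T) :=
    (convex_ball s ρ).inter (convex_Ico 0 T)
  filter_upwards [inter_mem_nhdsWithin (Set.Ico 0 T) (Metric.ball_mem_nhds s hρ)] with z hz
  have hN := Metric.tendstoUniformlyOn_iff.1 (hG t₀ h1) (ε / 2) (half_pos hε)
  have hev : ∀ᶠ N in atTop, ‖f N z - f N s - (z - s) • G s‖ ≤ ε * ‖z - s‖ := by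
    filter_upwards [hN] with N hN
    -- Mean value inequality for `f N t - t • G s`, whose derivative is within `ε` of zero near `s`;
    -- the limit in `N` is taken afterwards.
    have key := hconv.norm_image_sub_le_of_norm_hasDerivWithin_le (𝕜 := ℝ)
      (f := fun t => f N t - t • G s) (f' := fun t => g N t - G s) (C := ε) (x := s) (y := z)
      (fun t ht => by
        have e1 := (hf N t ht.2).mono (Set.inter_subset_right (s := Metric.ball s ρ))
        have e2 := ((hasDerivAt_id t).smul_const (G s)).hasDerivWithinAt
          (s := Metric.ball s ρ ∩ Set.Ico 0 T)
        exact (e1.sub e2).congr_deriv (by simp))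
      (fun t ht => by
        have e1 := hball ht
        have e2 := hN t e1.2
        have e3 : dist (G t) (G s) < ε / 2 := e1.1
        rw [← dist_eq_norm]
        have := dist_triangle (g N t) (G t) (G s)
        rw [dist_comm] at e2
        linarith)
      ⟨Metric.mem_ball_self hρ, hs⟩ ⟨hz.2, hz.1⟩
    convert key using 2
    rw [sub_smul]; abel
  have hlim := (((hF z hz.1).sub (hF s hs)).sub_const ((z - s) • G s)).norm
  exact le_of_tendsto hlim hev

/-- Solutions `u N`, with derivatives `y N`, of the systems with the first `N` columns of `m`. -/
structure IsTruncatedFamily (m : ℕ → ℕ → ℂ) {top : ℝ} (x : WeightedL1 top)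
    (u y : ℕ → ℝ → WeightedL1 top) : Prop where
  initial : ∀ N, u N 0 = x
  deriv : ∀ N t, HasDerivAt (u N) (y N t) t
  sum : ∀ N t n, HasSum (fun k => truncCols N m n k * u N t k) (y N t n)

namespace IsTruncatedFamily

variable {αs top M a : ℝ} {d : ℕ → ℝ} {b c : ℕ → ℕ → ℂ} {x : WeightedL1 top}
  {u y : ℕ → ℝ → WeightedL1 top}

theorem continuous (hu : IsTruncatedFamily (fullMatrix d b c) x u y) (N : ℕ) :
    Continuous (u N) :=
  continuous_iff_continuousAt.2 fun t => (hu.deriv N t).continuousAt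

theorem norm_le (hu : IsTruncatedFamily (fullMatrix d b c) x u y)
    (h : ScaleMatrix αs top M d b c) (ha : 0 < a) (haM : 4 * a * M < 1) (N : ℕ) {β : ℝ}
    (hαβ : αs < β) (hβ : β < top) {t : ℝ} (ht : 0 ≤ t) (htβ : t < a * (top - β)) :
    ‖embed hβ.le (u N t)‖ ≤
      ‖x‖ / (1 - 4 * a * M) * (a * (top - β) / (a * (top - β) - t)) := by
  obtain ⟨K, hK⟩ := (isCompact_Icc (a := (0 : ℝ)) (b := a * (top - β))).exists_bound_of_continuousOn
    (hu.continuous N).continuousOn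
  have hev : ScaleMatrix.Evolves αs a (a * (top - β)) 0 (truncCols N (fullMatrix d b c)) (u N) :=
    ⟨fun σ _ hσ s _ _ _ => ⟨embed hσ.le (y N s), 0,
      hasDerivWithinAt_embed _ (hu.deriv N s).hasDerivWithinAt,
      fun n => by simpa [WeightedL1.zero_apply, embed_apply] using hu.sum N s n, by simp⟩⟩
  rw [truncCols_fullMatrix] at hev
  exact (h.trunc N).apriori ha haM le_rfl (ht.trans htβ.le) hev (by simp [hu.initial])
    (fun s h0 hs => hK s ⟨h0, hs.le⟩) β hαβ hβ t ht htβ htβ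

/-- With `A_N` the truncated matrix, `A_N u_N - A_L u_L = A_N (u_N - u_L) + (A_N - A_L) u_L`. The
last term involves only columns from `N` on. One `ν / 2` of weight pays for the unbounded matrix,
the other for the decay in `N`; the second `ν` keeps `u_L` away from the singularity of its bound.
-/
theorem evolves_sub (hu : IsTruncatedFamily (fullMatrix d b c) x u y)
    (h : ScaleMatrix αs top M d b c) (ha : 0 < a) (haM : 4 * a * M < 1) {ν τ : ℝ} (hν : 0 < ν) :
    ∃ K, 0 ≤ K ∧ ∀ {top' : ℝ} (ht : top' ≤ top), top' + ν + ν ≤ top → ∀ N L : ℕ, N ≤ L →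
      ScaleMatrix.Evolves αs a τ (K * Real.exp (-(ν / 2) * N)) (truncCols N (fullMatrix d b c))
        (fun t => embed ht (u N t - u L t)) := by
  obtain ⟨K, hK, hcol⟩ := h.exists_colBound (half_pos hν)
  set R := ‖x‖ / (1 - 4 * a * M) * (a * (|top - αs|) / (a * ν)) with hR
  have h1θ : 0 < 1 - 4 * a * M := by linarith
  have hR0 : 0 ≤ R := by positivity
  refine ⟨K * R, by positivity, fun {top'} ht htν N L hNL => ⟨?_⟩⟩
  intro σ hσ hσt s hs0 _ hsσ
  set γ := σ + ν / 2 + ν / 2 with hγ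
  have hγt : γ < top := by linarith
  have hσγ : σ ≤ γ := by linarith
  have htail : ColBound (fun n k => truncCols N (fullMatrix d b c) n k -
      truncCols L (fullMatrix d b c) n k) γ σ (K * Real.exp (-(ν / 2) * N)) := by
    refine (hcol σ hσ (by linarith)).tail hK (half_pos hν).le (fun n k hk => ?_) (fun n k => ?_)
    · simp [truncCols, hk, hk.trans_le hNL]
    · by_cases hkN : k < N
      · simp [truncCols, hkN, hkN.trans_le hNL]
      · by_cases hkL : k < L <;> simp [truncCols, hkN, hkL]
  obtain ⟨f, hf, hfn⟩ := htail.exists_apply (embed hγt.le (u L s))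
  have hgap : a * ν ≤ a * (top - γ) - s := by
    have : a * (top' - σ) + a * ν ≤ a * (top - γ) := by
      rw [← mul_add]; gcongr; linarith
    linarith
  have haν : 0 < a * ν := by positivity
  have hbd : ‖embed hγt.le (u L s)‖ ≤ R := by
    refine (hu.norm_le h ha haM L (by linarith) hγt hs0 (by linarith)).trans ?_
    rw [hR]
    gcongr
    exact le_trans (by linarith) (le_abs_self _)
  refine ⟨embed (hσt.le.trans ht) (y N s - y L s), f, ?_, fun n => ?_, ?_⟩
  · exact hasDerivWithinAt_embed (hσt.le.trans ht)
      ((hu.deriv N s).sub (hu.deriv L s)).hasDerivWithinAt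
  · have := ((hu.sum N s n).sub (hu.sum L s n)).sub (hf n)
    refine this.congr_fun fun k => ?_
    simp only [embed_apply, WeightedL1.sub_apply]
    ring
  · refine hfn.trans ?_
    rw [mul_right_comm]
    gcongr

/-- The difference starts at zero, so its a priori bound is proportional to the forcing. Lowering
`top` to `top'` makes room for the loss in `evolves_sub`, with `t₀ < a * (top' - β)` still true. -/
theorem exists_cauchy_bound (hu : IsTruncatedFamily (fullMatrix d b c) x u y)
    (h : ScaleMatrix αs top M d b c) (ha : 0 < a) (haM : 4 * a * M < 1) {β t₀ : ℝ}
    (hαβ : αs < β) (hβ : β < top) (htβ : t₀ < a * (top - β)) :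
    ∃ η : ℕ → ℝ, Tendsto η atTop (𝓝 0) ∧ ∀ N L : ℕ, N ≤ L → ∀ t ∈ Set.Icc 0 t₀,
      ‖embed hβ.le (u N t) - embed hβ.le (u L t)‖ ≤ η N := by
  obtain ⟨top', h1, h2⟩ : ∃ top', β + max t₀ 0 / a < top' ∧ top' < top := by
    refine exists_between ?_
    have : max t₀ 0 / a < top - β := by
      rw [div_lt_iff₀ ha, mul_comm]
      exact max_lt htβ (mul_pos ha (sub_pos.2 hβ))
    linarith
  have h3 : max t₀ 0 < a * (top' - β) := by
    rw [mul_comm, ← div_lt_iff₀ ha]; linarith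
  have hβ' : β < top' := by
    have : 0 ≤ max t₀ 0 / a := by positivity
    linarith
  set ν := (top - top') / 2 with hν
  have hν0 : 0 < ν := by linarith
  set τ := a * (top' - β) with hτ
  obtain ⟨K, hK, hev⟩ := hu.evolves_sub h ha haM (τ := τ) hν0
  have h1θ : 0 < 1 - 4 * a * M := by linarith
  have h4 : t₀ < τ := (le_max_left _ _).trans_lt h3
  have h5 : 0 < τ := (le_max_right _ _).trans_lt h3
  have h6 : 0 < τ - t₀ := sub_pos.2 h4
  refine ⟨fun N => K * Real.exp (-(ν / 2) * N) * τ / (1 - 4 * a * M) * (τ / (τ - t₀)), ?_, ?_⟩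
  · have hexp : Tendsto (fun N : ℕ => Real.exp (-(ν / 2) * N)) atTop (𝓝 0) := by
      refine Real.tendsto_exp_atBot.comp ?_
      exact tendsto_natCast_atTop_atTop.const_mul_atTop_of_neg (by linarith)
    have := (((hexp.const_mul K).mul_const τ).div_const (1 - 4 * a * M)).mul_const (τ / (τ - t₀))
    simpa using this
  · intro N L hNL t ht
    have hev' := hev h2.le (by linarith) N L hNL
    rw [truncCols_fullMatrix] at hev'
    obtain ⟨B, hB⟩ := (isCompact_Icc (a := (0 : ℝ)) (b := τ)).exists_bound_of_continuousOn
      ((hu.continuous N).sub (hu.continuous L)).continuousOn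
    have key := ((h.mono_top h2.le).trunc N).apriori ha haM (by positivity) h5.le hev'
      (X := K * Real.exp (-(ν / 2) * N) * τ)
      (by
        have : embed h2.le (u N 0 - u L 0) = 0 := by
          rw [hu.initial, hu.initial, sub_self]; rfl
        rw [this, norm_zero, zero_add])
      (fun s h0 hs => (norm_embed_le _ _).trans (hB s ⟨h0, hs.le⟩)) β hαβ hβ' t ht.1
      (ht.2.trans_lt h4) (ht.2.trans_lt h4)
    refine key.trans ?_
    beta_reduce
    rw [← hτ]
    have := ht.2
    gcongr

theorem exists_limit (hu : IsTruncatedFamily (fullMatrix d b c) x u y)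
    (h : ScaleMatrix αs top M d b c) (ha : 0 < a) (haM : 4 * a * M < 1) {β t₀ : ℝ}
    (hαβ : αs < β) (hβ : β < top) (htβ : t₀ < a * (top - β)) :
    ∃ (U : ℝ → WeightedL1 β) (R : ℝ) (η : ℕ → ℝ), Tendsto η atTop (𝓝 0) ∧
      ∀ t ∈ Set.Icc 0 t₀, ‖U t‖ ≤ R ∧ ∀ N, ‖embed hβ.le (u N t) - U t‖ ≤ η N := by
  obtain ⟨η, hη, hC⟩ := hu.exists_cauchy_bound h ha haM hαβ hβ htβ
  have hex : ∀ t, ∃ v : WeightedL1 β, t ∈ Set.Icc 0 t₀ →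
      Tendsto (fun N => embed hβ.le (u N t)) atTop (𝓝 v) := by
    intro t
    by_cases ht : t ∈ Set.Icc 0 t₀
    swap
    · exact ⟨0, fun h => absurd h ht⟩
    have hcs : CauchySeq fun N => embed hβ.le (u N t) := by
      rw [Metric.cauchySeq_iff']
      intro ε hε
      obtain ⟨N, hN⟩ := (hη.eventually (gt_mem_nhds hε)).exists
      refine ⟨N, fun L hL => ?_⟩
      rw [dist_comm, dist_eq_norm]
      exact (hC N L hL t ht).trans_lt hN
    obtain ⟨v, hv⟩ := cauchySeq_tendsto_of_complete hcs
    exact ⟨v, fun _ => hv⟩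
  choose U hU using hex
  refine ⟨U, ‖x‖ / (1 - 4 * a * M) * (a * (top - β) / (a * (top - β) - t₀)), η, hη,
    fun t ht => ⟨?_, fun N => ?_⟩⟩
  · refine le_of_tendsto' (hU t ht).norm fun N => ?_
    have ht2 := ht.2
    have h1θ : 0 < 1 - 4 * a * M := by linarith
    have hδ : 0 < top - β := sub_pos.2 hβ
    have h6 : 0 < a * (top - β) - t₀ := sub_pos.2 htβ
    refine (hu.norm_le h ha haM N hαβ hβ ht.1 (ht2.trans_lt htβ)).trans ?_
    gcongr
  · refine le_of_tendsto (((hU t ht).const_sub (embed hβ.le (u N t))).norm) ?_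
    filter_upwards [eventually_ge_atTop N] with L hL
    exact hC N L hL t ht

theorem exists_uniform_limit (hu : IsTruncatedFamily (fullMatrix d b c) x u y)
    (h : ScaleMatrix αs top M d b c) (ha : 0 < a) (haM : 4 * a * M < 1) {β t₀ : ℝ}
    (hαβ : αs < β) (hβ : β < top) (htβ : t₀ < a * (top - β)) :
    ∃ U V : ℝ → WeightedL1 β,
      (∀ t ∈ Set.Icc 0 t₀, Tendsto (fun N => embed hβ.le (u N t)) atTop (𝓝 (U t))) ∧
      TendstoUniformlyOn (fun N t => embed hβ.le (y N t)) V atTop (Set.Icc 0 t₀) ∧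
      ∀ t ∈ Set.Icc 0 t₀, ∀ n, HasSum (fun k => fullMatrix d b c n k * U t k) (V t n) := by
  have hmax : max t₀ 0 / a < top - β := by
    rw [div_lt_iff₀ ha, mul_comm]
    exact max_lt htβ (mul_pos ha (sub_pos.2 hβ))
  have hmax0 : 0 ≤ max t₀ 0 / a := by positivity
  -- A quarter of the slack: raising `β` by `2 * ν` still leaves `t₀` inside the lifespan. The
  -- maximum covers negative `t₀`.
  set ν := (top - β - max t₀ 0 / a) / 4 with hν
  have hν0 : 0 < ν := by linarith
  set γ := β + ν + ν with hγ
  have hγt : γ < top := by linarith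
  have hβγ : β < γ := by linarith
  have htγ : t₀ < a * (top - γ) := by
    refine (le_max_left t₀ 0).trans_lt ?_
    rw [mul_comm, ← div_lt_iff₀ ha]
    linarith
  obtain ⟨U, R, η, hη, hU⟩ := hu.exists_limit h ha haM (hαβ.trans hβγ) hγt htγ
  obtain ⟨K, hK, hcol⟩ := h.exists_colBound hν0
  have hcol := hcol β hαβ (by linarith)
  -- With cutoff zero the decay factor is one, so `tail` merely strengthens the domain norm from `β
  -- + ν` to `γ`.
  have htr : ∀ N, ColBound (truncCols N (fullMatrix d b c)) γ β K := fun N => by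
    simpa using (hcol.truncCols hK N).tail (N := 0) hK hν0.le (by simp) fun _ _ => le_rfl
  have hfull : ColBound (fullMatrix d b c) γ β K := by
    simpa using hcol.tail (N := 0) hK hν0.le (by simp) fun _ _ => le_rfl
  have htail : ∀ N : ℕ, ColBound (fun n k => fullMatrix d b c n k -
      truncCols N (fullMatrix d b c) n k) γ β (K * Real.exp (-ν * N)) := fun N =>
    hcol.tail hK hν0.le (fun n k hk => by simp [truncCols, hk]) fun n k => by
      by_cases hk : k < N <;> simp [truncCols, hk]
  choose V hV _ using fun t => hfull.exists_apply (U t)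
  refine ⟨fun t => embed hβγ.le (U t), V, fun t ht => ?_, ?_, fun t _ => hV t⟩
  · have h1 : Tendsto (fun N => embed hγt.le (u N t)) atTop (𝓝 (U t)) := by
      rw [tendsto_iff_norm_sub_tendsto_zero]
      exact squeeze_zero (fun _ => norm_nonneg _) (hU t ht).2 hη
    exact ((embedCLM hβγ.le).continuous.tendsto (U t)).comp h1
  · have hle : ∀ N, ∀ t ∈ Set.Icc 0 t₀,
        ‖embed hβ.le (y N t) - V t‖ ≤ K * η N + K * Real.exp (-ν * N) * R := by
      intro N t ht
      obtain ⟨p, hp, hpn⟩ := (htr N).exists_apply (embed hγt.le (u N t) - U t)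
      obtain ⟨r, hr, hrn⟩ := (htail N).exists_apply (U t)
      -- `A_N u_N - A U = A_N (u_N - U) - (A - A_N) U`: convergence at weight `γ` handles the first
      -- term, column decay the second.
      have e : embed hβ.le (y N t) - V t = p - r := by
        ext n
        refine HasSum.unique ((hu.sum N t n).sub (hV t n)) ?_
        refine ((hp n).sub (hr n)).congr_fun fun k => ?_
        simp only [WeightedL1.sub_apply, embed_apply]
        ring
      rw [e]
      refine (norm_sub_le _ _).trans (add_le_add ?_ ?_)
      · exact hpn.trans (mul_le_mul_of_nonneg_left ((hU t ht).2 N) hK)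
      · exact hrn.trans (mul_le_mul_of_nonneg_left (hU t ht).1 (by positivity))
    have hexp : Tendsto (fun N : ℕ => Real.exp (-ν * N)) atTop (𝓝 0) :=
      Real.tendsto_exp_atBot.comp
        (tendsto_natCast_atTop_atTop.const_mul_atTop_of_neg (by linarith))
    have hlim : Tendsto (fun N => K * η N + K * Real.exp (-ν * N) * R) atTop (𝓝 0) := by
      simpa using (hη.const_mul K).add ((hexp.const_mul K).mul_const R)
    rw [Metric.tendstoUniformlyOn_iff]
    intro ε hε
    filter_upwards [hlim.eventually (gt_mem_nhds hε)] with N hN t ht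
    rw [dist_comm, dist_eq_norm]
    exact (hle N t ht).trans_lt hN

end IsTruncatedFamily

theorem ScaleMatrix.exists_isClassicalSolution {αs top M a : ℝ} {d : ℕ → ℝ} {b c : ℕ → ℕ → ℂ}
    (h : ScaleMatrix αs top M d b c)
    (hc : ∀ k : ℕ, Summable fun n : ℕ => ‖c n k‖ * Real.exp (top * n))
    (ha : 0 < a) (haM : 4 * a * M < 1) {β : ℝ} (hαβ : αs < β) (hβ : β < top)
    (x : WeightedL1 top) :
    ∃ u : ℝ → WeightedL1 β, IsClassicalSolution (fullMatrix d b c) x (a * (top - β)) u := by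
  choose u y hu0 hu using h.exists_truncated (hαβ.trans hβ) hc x
  have hfam : IsTruncatedFamily (fullMatrix d b c) x u y :=
    ⟨hu0, fun N t => (hu N t).1, fun N t => (hu N t).2⟩
  set T := a * (top - β) with hT
  have hT0 : 0 < T := mul_pos ha (sub_pos.2 hβ)
  -- The limits obtained above depend on `t₀`; `limUnder` gives one function agreeing with all of
  -- them.
  set F : ℝ → WeightedL1 β := fun t => limUnder atTop fun N => embed hβ.le (u N t)
  set G : ℝ → WeightedL1 β := fun t => limUnder atTop fun N => embed hβ.le (y N t)
  have hloc : ∀ t₀ < T,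
      (∀ t ∈ Set.Icc 0 t₀, Tendsto (fun N => embed hβ.le (u N t)) atTop (𝓝 (F t))) ∧
      TendstoUniformlyOn (fun N t => embed hβ.le (y N t)) G atTop (Set.Icc 0 t₀) ∧
      ∀ t ∈ Set.Icc 0 t₀, ∀ n, HasSum (fun k => fullMatrix d b c n k * F t k) (G t n) := by
    intro t₀ ht₀
    obtain ⟨U, V, hU, hV, hUV⟩ := hfam.exists_uniform_limit h ha haM hαβ hβ ht₀
    have hF : ∀ t ∈ Set.Icc 0 t₀, F t = U t := fun t ht => (hU t ht).limUnder_eq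
    have hG : ∀ t ∈ Set.Icc 0 t₀, G t = V t := fun t ht => (hV.tendsto_at ht).limUnder_eq
    refine ⟨fun t ht => ?_, hV.congr_right fun t ht => (hG t ht).symm, fun t ht => ?_⟩
    · rw [hF t ht]; exact hU t ht
    · rw [hF t ht, hG t ht]; exact hUV t ht
  have hy : ∀ N, Continuous fun t => embed hβ.le (y N t) := by
    intro N
    obtain ⟨K, hK⟩ := h.exists_colBound_truncCols hc (hαβ.trans hβ) N
    refine (embedCLM hβ.le).continuous.comp (continuous_iff_continuousAt.2 fun t => ?_)
    have hle : ∀ s, ‖y N s - y N t‖ ≤ K * ‖u N s - u N t‖ := fun s =>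
      hK.norm_le fun n => (((hu N s).2 n).sub ((hu N t).2 n)).congr_fun fun k => by
        rw [WeightedL1.sub_apply]; ring
    have h1 : Tendsto (fun s => K * ‖u N s - u N t‖) (𝓝 t) (𝓝 0) := by
      simpa using (tendsto_iff_norm_sub_tendsto_zero.1
        (hfam.continuous N).continuousAt).const_mul K
    exact tendsto_iff_norm_sub_tendsto_zero.2 (squeeze_zero (fun _ => norm_nonneg _) hle h1)
  have hlim := hasDerivWithinAt_of_tendstoUniformlyOn_Icc (T := T)
    (f := fun N t => embed hβ.le (u N t)) (g := fun N t => embed hβ.le (y N t)) (F := F) (G := G)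
    (fun N t _ => hasDerivWithinAt_embed _ (hu N t).1.hasDerivWithinAt)
    (fun N => (hy N).continuousOn)
    (fun t ht => (hloc t ht.2).1 t ⟨ht.1, le_rfl⟩) (fun t₀ ht₀ => (hloc t₀ ht₀).2.1)
  refine ⟨F, ?_, G, hlim.1, fun t ht => ⟨hlim.2 t ht, (hloc t ht.2).2.2 t ⟨ht.1, le_rfl⟩⟩⟩
  have h0 := (hloc 0 hT0).1 0 ⟨le_rfl, le_rfl⟩
  simp only [hu0] at h0
  intro n
  rw [tendsto_nhds_unique h0 tendsto_const_nhds, embed_apply]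

end

theorem theorem4p1
    (a : ℕ → ℕ → ℂ) (αs : ℝ)
    -- decomposition of the matrix
    (d : ℕ → ℝ) (b c : ℕ → ℕ → ℂ) (hd : ∀ n, 0 < d n)
    (ha : ∀ n k, a n k = -(if n = k then (d n : ℂ) else 0) + b n k + c n k)
    -- `b` is dominated by the diagonal part
    (q : ℝ → ℝ) (hq : ∀ α, αs < α → 0 < q α ∧ q α < 1)
    (hb : ∀ α, αs < α → ∀ k : ℕ,
      Summable (fun n : ℕ => ‖b n k‖ * Real.exp (α * n)) ∧
      Real.exp (-α * k) * ∑' n : ℕ, ‖b n k‖ * Real.exp (α * n) ≤ q α * d k)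
    -- `d` grows subexponentially
    (hd_growth : ∀ ν : ℝ, 0 < ν →
      BddAbove (Set.range fun n : ℕ => d n * Real.exp (-ν * n)))
    -- `c` loses regularity with a first-order singularity
    (M : ℝ → ℝ) (hM_cont : ContinuousOn M (Set.Ioi αs)) (hM_mono : MonotoneOn M (Set.Ioi αs))
    (hM_pos : ∀ α, αs < α → 0 < M α)
    (hc : ∀ α' α, αs < α' → α' < α → ∀ k : ℕ,
      Summable (fun n : ℕ => ‖c n k‖ * Real.exp (α' * n)) ∧
      Real.exp (-α * k) * ∑' n : ℕ, ‖c n k‖ * Real.exp (α' * n) ≤ M α / (α - α')) :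
    ∀ α' α : ℝ, αs < α' → α' < α → ∀ x : WeightedL1 α,
      ∃ u : ℝ → WeightedL1 α',
        IsClassicalSolution a x ((α - α') / (2 * Real.exp 1 * M α)) u ∧
        -- uniqueness among classical solutions in `E_α'`
        (∀ v : ℝ → WeightedL1 α',
          IsClassicalSolution a x ((α - α') / (2 * Real.exp 1 * M α)) v →
          Set.EqOn v u (Set.Ico 0 ((α - α') / (2 * Real.exp 1 * M α)))) ∧
        -- and even among the solutions that are differentiable only in the larger spaces
        (∀ v : ℝ → WeightedL1 α',
          IsScaleSolution a x ((α - α') / (2 * Real.exp 1 * M α)) αs v →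
          Set.EqOn v u (Set.Ico 0 ((α - α') / (2 * Real.exp 1 * M α)))) := by
  intro α' α hα' hα x
  obtain rfl : a = fullMatrix d b c := funext fun n => funext fun k => ha n k
  have hM := hM_pos α (hα'.trans hα)
  have e1 : ∀ α k : ℝ, Real.exp (-α * k) = (Real.exp (α * k))⁻¹ := fun α k => by
    rw [neg_mul, Real.exp_neg]
  have h : ScaleMatrix αs α (M α) d b c :=
    { M_pos := hM
      d_nonneg := fun n => (hd n).le
      b_col := fun β hβ k => by
        refine ⟨(hb β hβ k).1, ?_⟩
        have h1 := (hb β hβ k).2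
        rw [e1, inv_mul_le_iff₀ (Real.exp_pos _)] at h1
        refine h1.trans ?_
        rw [mul_comm]
        exact mul_le_mul_of_nonneg_right
          (mul_le_of_le_one_left (hd k).le (hq β hβ).2.le) (Real.exp_pos _).le
      d_growth := fun ν hν => by
        obtain ⟨K, hK⟩ := hd_growth ν hν
        refine ⟨K, fun n => ?_⟩
        have h1 : d n * Real.exp (-ν * n) ≤ K := hK ⟨n, rfl⟩
        rwa [e1, ← div_eq_mul_inv, div_le_iff₀ (Real.exp_pos _)] at h1
      c_col := fun β γ hβ hβγ hγ k => by
        refine ⟨(hc β γ hβ hβγ k).1, ?_⟩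
        have h1 := (hc β γ hβ hβγ k).2
        rw [e1, inv_mul_le_iff₀ (Real.exp_pos _), mul_comm] at h1
        refine h1.trans (mul_le_mul_of_nonneg_right ?_ (Real.exp_pos _).le)
        -- Monotonicity of `M` lets the single constant `M α` serve all weights up to `α`.
        exact div_le_div_of_nonneg_right
          (hM_mono (hβ.trans hβγ) (hα'.trans hα) hγ) (sub_pos.2 hβγ).le }
  have haM : 4 * (1 / (2 * Real.exp 1 * M α)) * M α < 1 := by
    have h1 : 4 * (1 / (2 * Real.exp 1 * M α)) * M α = 2 / Real.exp 1 := by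
      field_simp
      norm_num
    rw [h1, div_lt_one (Real.exp_pos 1)]
    linarith [Real.exp_one_gt_d9]
  -- The truncated operators act on `E_α` itself, so the columns of `c` must lie there; the bound on
  -- `c` from the weight `α + 1` gives this.
  obtain ⟨u, hu⟩ := h.exists_isClassicalSolution
    (fun k => (hc α (α + 1) (hα'.trans hα) (by linarith) k).1) (by positivity) haM hα' hα x
  rw [one_div_mul_eq_div] at hu
  have huniq := fun v hv =>
    (h.mono_top hα.le).eqOn_of_isScaleSolution hα' (v := v) hu.isScaleSolution hv
  exact ⟨u, hu, fun v hv => huniq v hv.isScaleSolution, huniq⟩
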